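/- Let $p\ge 0$ be an integer and write $(x,y)=(x_1,\dots,x_p,y_1,\dots,y_p)$ for the coordinates of $\mathbb{R}^{2p}$. For a smooth function $f$ on an open set $\mathcal{O}\subseteq\mathbb{R}^p$ let $M=\mathcal{O}\times\mathbb{R}^p$ and let $g_f$ be the symmetric $2$-tensor on $M$ with $$g_f(\partial_i^x,\partial_j^x)=\partial_i^xf\cdot\partial_j^xf,\qquad g_f(\partial_i^x,\partial_j^y)=\delta_{ij},\qquad g_f(\partial_i^y,\partial_j^y)=0 .$$ Let $L_f^{\mathcal X}$ be the quadratic form $L_f(\partial_i^x,\partial_j^x)=\partial_i^x\partial_j^xf$ on $\operatorname{Span}\{\partial_1^x,\dots,\partial_p^x\}$. Let $R_g$ be the curvature tensor of a pseudo-Riemannian metric $g$, with the sign convention $R_g(X,Y,Z,W)=g((\nabla_X\nabla_Y-\nabla_Y\nabla_X-\nabla_{[X,Y]})Z,W)$, where $\nabla$ is the Levi-Civita connection. Let $V$ be a real vector space with basis $\{u_1,\dots,u_p,v_1,\dots,v_p\}$. Let $(\cdot,\cdot)$ be the symmetric bilinear form and $R$ the $4$-linear form on $V$ whose only non-zero entries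 on basis vectors are given by $$(u_i,v_j)=(v_j,u_i)=\delta_{ij},\qquad R(u_i,u_j,u_k,u_l)=\delta_{il}\delta_{jk}-\delta_{ik}\delta_{jl}.$$ A pseudo-Riemannian manifold $(N,g)$ is said to be modeled on $(V,(\cdot,\cdot),R)$ if for every $P\in N$ there is a linear isomorphism $\Psi:V\to T_PN$ with $\Psi^*g_P=(\cdot,\cdot)$ and $\Psi^*(R_g)_P=R$. Then: 1. $(\cdot,\cdot)$ is an inner product of signature $(p,p)$ and $R$ is an algebraic curvature tensor, i.e. $R(a,b,c,d)=-R(b,a,c,d)=R(c,d,a,b)$ and $R(a,b,c,d)+R(b,c,a,d)+R(c,a,b,d)=0$. 2. For all $\mathcal{O}$ and $f$ as above, $(M,g_f)$ is a pseudo-Riemannian manifold of signature $(p,p)$; if $L_f^{\mathcal X}$ is positive definite at every point of $M$, then $(M,g_f)$ is modeled on $(V,(\cdot,\cdot),R)$. 3. For $f_0=\tfrac12(x_1^2+\dots+x_p^2)$ on $\mathcal{O}=\mathbb{R}^p$, the form $L_{f_0}^{\mathcal X}$ is positive definite, and $(\mathbb{R}^{2p},g_{f_0})$ is modeled on $(V,(\cdot,\cdot),R)$.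 Moreover $\nabla R_{g_{f_0}}=0$, and $(\mathbb{R}^{2p},g_{f_0})$ is a symmetric space (it is connected, and each point $P$ is fixed by an isometry of the whole space with differential $-\mathrm{id}$ at $P$) and is locally homogeneous (for any two points $P,Q$ there is an isometry from a neighborhood of $P$ to a neighborhood of $Q$ that takes $P$ to $Q$). 4. Consequently there are pseudo-Riemannian manifolds that are not locally homogeneous but whose metric and curvature tensor are modeled on those of a symmetric space: for every $p\ge3$ there is a smooth $f:\mathbb{R}^p\to\mathbb{R}$ with $L_f^{\mathcal X}$ positive definite such that $(\mathbb{R}^{2p},g_f)$ is modeled on $(V,(\cdot,\cdot),R)$ and is not locally homogeneous. -/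

import Mathlib

open scoped ContDiff

noncomputable section

namespace CurvHom

/-! ### Pseudo-Riemannian geometry on open subsets of a finite-dimensional vector space

A metric on an open set `M ⊆ E` is a map `g : E → E →L[ℝ] E →L[ℝ] ℝ`, of which only the values on
`M` matter; all tangent spaces of `M` are identified with `E`, and the vectors of `E` are also read
as the constant (coordinate) vector fields. -/

/-- The bilinear form `B` is symmetric and has signature `(p, q)`: there is a basis in which it is
diagonal with `p` entries `-1` and `q` entries `+1`. In particular `B` is nondegenerate. -/
def HasSignature {V : Type*} [AddCommGroup V] [Module ℝ V] (B : V → V → ℝ) (p q : ℕ) : Prop :=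
  (∀ v w, B v w = B w v) ∧ (∀ w, IsLinearMap ℝ fun v => B v w) ∧
    ∃ e : Module.Basis (Fin p ⊕ Fin q) ℝ V,
      (∀ i, B (e (Sum.inl i)) (e (Sum.inl i)) = -1) ∧
      (∀ i, B (e (Sum.inr i)) (e (Sum.inr i)) = 1) ∧
      ∀ a b, a ≠ b → B (e a) (e b) = 0

section Geometry

variable {E : Type*} [NormedAddCommGroup E] [NormedSpace ℝ E]

/-- `g` is a smooth pseudo-Riemannian metric of signature `(p, q)` on the open set `M`. -/
def IsPseudoRiemannian (M : Set E) (g : E → E →L[ℝ] E →L[ℝ] ℝ) (p q : ℕ) : Prop :=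
  IsOpen M ∧ ContDiffOn ℝ ∞ g M ∧ ∀ P ∈ M, HasSignature (fun u v => g P u v) p q

/-- The Koszul expression `w ↦ (1/2) (u g(v,w) + v g(u,w) - w g(u,v))` at the point `P`, for
constant vector fields `u`, `v`, `w`. -/
def koszul (g : E → E →L[ℝ] E →L[ℝ] ℝ) (P u v : E) : E →L[ℝ] ℝ :=
  (1 / 2 : ℝ) • (fderiv ℝ g P u v + fderiv ℝ g P v u - ((fderiv ℝ g P).flip u).flip v)

/-- The Levi-Civita covariant derivative `∇_u v` at `P` of constant vector fields: the unique
vector with `g(∇_u v, w) = koszul g P u v w` for all `w`. -/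
def christoffel (g : E → E →L[ℝ] E →L[ℝ] ℝ) (P u v : E) : E :=
  (g P).inverse (koszul g P u v)

/-- The Riemann curvature tensor
`R(u,v,w,z) = g((∇_u ∇_v - ∇_v ∇_u - ∇_[u,v]) w, z)` at `P`. -/
def riemann (g : E → E →L[ℝ] E →L[ℝ] ℝ) (P u v w z : E) : ℝ :=
  g P (fderiv ℝ (fun Q => christoffel g Q v w) P u + christoffel g P u (christoffel g P v w)
    - fderiv ℝ (fun Q => christoffel g Q u w) P v - christoffel g P v (christoffel g P u w)) z

/-- The covariant derivative `∇R(u,v,w,z;e)` of the curvature tensor at `P`. -/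
def covDerivRiemann (g : E → E →L[ℝ] E →L[ℝ] ℝ) (P u v w z e : E) : ℝ :=
  fderiv ℝ (fun Q => riemann g Q u v w z) P e
    - riemann g P (christoffel g P e u) v w z - riemann g P u (christoffel g P e v) w z
    - riemann g P u v (christoffel g P e w) z - riemann g P u v w (christoffel g P e z)

/-- `ψ` is an isometry (smooth with smooth inverse, pulling `g` back to `g`) from the open set
`ψ.source` onto the open set `ψ.target`. -/
def IsIsometryFor (g : E → E →L[ℝ] E →L[ℝ] ℝ) (ψ : OpenPartialHomeomorph E E) : Prop :=
  ContDiffOn ℝ ∞ ψ ψ.source ∧ ContDiffOn ℝ ∞ ψ.symm ψ.target ∧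
    ∀ P ∈ ψ.source, ∀ u v : E, g (ψ P) (fderiv ℝ ψ P u) (fderiv ℝ ψ P v) = g P u v

/-- For any two points `P`, `Q` of `M` an isometry between neighborhoods of them in `M` takes `P` to
`Q`. -/
def IsLocallyHomogeneous (M : Set E) (g : E → E →L[ℝ] E →L[ℝ] ℝ) : Prop :=
  ∀ P ∈ M, ∀ Q ∈ M, ∃ ψ : OpenPartialHomeomorph E E,
    ψ.source ⊆ M ∧ ψ.target ⊆ M ∧ IsIsometryFor g ψ ∧ P ∈ ψ.source ∧ ψ P = Q

/-- `(M, g)` is locally symmetric: `∇R = 0`. -/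
def IsLocallySymmetric (M : Set E) (g : E → E →L[ℝ] E →L[ℝ] ℝ) : Prop :=
  ∀ P ∈ M, ∀ u v w z e : E, covDerivRiemann g P u v w z e = 0

/-- `(M, g)` is a (globally) symmetric space: it is connected, and every point `P` is fixed by an
isometry of `M` onto itself whose differential at `P` is `-1`. -/
def IsSymmetricSpace (M : Set E) (g : E → E →L[ℝ] E →L[ℝ] ℝ) : Prop :=
  IsConnected M ∧ ∀ P ∈ M, ∃ s : OpenPartialHomeomorph E E,
    s.source = M ∧ s.target = M ∧ IsIsometryFor g s ∧ s P = P ∧ ∀ u, fderiv ℝ s P u = -u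

/-- `(V, B, R)` is a model for the metric and curvature tensor of `(M, g)`: at every point of `M`
there is a linear isomorphism from `V` to the tangent space identifying `B` with the metric and `R`
with the curvature tensor. -/
def IsModeledOn (M : Set E) (g : E → E →L[ℝ] E →L[ℝ] ℝ)
    {V : Type*} [AddCommGroup V] [Module ℝ V] (B : V → V → ℝ) (R : V → V → V → V → ℝ) : Prop :=
  ∀ P ∈ M, ∃ Ψ : V ≃ₗ[ℝ] E, (∀ a b, g P (Ψ a) (Ψ b) = B a b) ∧
    ∀ a b c d, riemann g P (Ψ a) (Ψ b) (Ψ c) (Ψ d) = R a b c d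

end Geometry

/-! ### Algebraic curvature tensors and the algebraic model -/

section Algebra

variable {V : Type*} [AddCommGroup V] [Module ℝ V]

/-- A `4`-linear form on `V` with the symmetries of the Riemann curvature tensor. -/
def IsAlgebraicCurvatureTensor (R : V → V → V → V → ℝ) : Prop :=
  (∀ b c d, IsLinearMap ℝ fun v => R v b c d) ∧ (∀ a c d, IsLinearMap ℝ fun v => R a v c d) ∧
  (∀ a b d, IsLinearMap ℝ fun v => R a b v d) ∧ (∀ a b c, IsLinearMap ℝ fun v => R a b c v) ∧
  (∀ a b c d, R a b c d = -R b a c d) ∧ (∀ a b c d, R a b c d = R c d a b) ∧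
  ∀ a b c d, R a b c d + R b c a d + R c a b d = 0

/-- The inner product with `(u_i, v_j) = (v_j, u_i) = δ_ij`, all other entries being zero, where
`u_i = b (inl i)` and `v_i = b (inr i)`. -/
def modelInner {p : ℕ} (b : Module.Basis (Fin p ⊕ Fin p) ℝ V) (x y : V) : ℝ :=
  ∑ i, (b.repr x (Sum.inl i) * b.repr y (Sum.inr i) + b.repr x (Sum.inr i) * b.repr y (Sum.inl i))

/-- The `4`-tensor whose value on basis vectors is `δ_il δ_jk - δ_ik δ_jl` on
`(u_i, u_j, u_k, u_l)` and zero if some entry is a `v_i`. -/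
def modelCurvature {p : ℕ} (b : Module.Basis (Fin p ⊕ Fin p) ℝ V) (x y z w : V) : ℝ :=
  ∑ i, ∑ j, ∑ k, ∑ l,
    b.repr x (Sum.inl i) * b.repr y (Sum.inl j) * b.repr z (Sum.inl k) * b.repr w (Sum.inl l) *
      ((if i = l then 1 else 0) * (if j = k then 1 else 0)
        - (if i = k then 1 else 0) * (if j = l then 1 else 0))

end Algebra

/-! ### The manifolds `(M, g_f)` -/

/-- The space `ℝ^{2p}` with coordinates `(x, y)`. -/
abbrev Coord (p : ℕ) : Type := EuclideanSpace ℝ (Fin p) × EuclideanSpace ℝ (Fin p)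

/-- `M = O × ℝ^p`. -/
def carrier {p : ℕ} (O : Set (EuclideanSpace ℝ (Fin p))) : Set (Coord p) := O ×ˢ Set.univ

/-- The metric `g_f = df ⊗ df + ∑ i, (dx_i ⊗ dy_i + dy_i ⊗ dx_i)`, that is
`g_f(∂_i^x, ∂_j^x) = ∂_i f ∂_j f`, `g_f(∂_i^x, ∂_j^y) = δ_ij` and `g_f(∂_i^y, ∂_j^y) = 0`. -/
def gMetric {p : ℕ} (f : EuclideanSpace ℝ (Fin p) → ℝ) (P : Coord p) :
    Coord p →L[ℝ] Coord p →L[ℝ] ℝ :=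
  let df : Coord p →L[ℝ] ℝ := (fderiv ℝ f P.1).comp (ContinuousLinearMap.fst ℝ _ _)
  let dx (i : Fin p) : Coord p →L[ℝ] ℝ :=
    (EuclideanSpace.proj i).comp (ContinuousLinearMap.fst ℝ _ _)
  let dy (i : Fin p) : Coord p →L[ℝ] ℝ :=
    (EuclideanSpace.proj i).comp (ContinuousLinearMap.snd ℝ _ _)
  df.smulRight df + ∑ i, ((dx i).smulRight (dy i) + (dy i).smulRight (dx i))

theorem gMetric_apply {p : ℕ} (f : EuclideanSpace ℝ (Fin p) → ℝ) (P Z W : Coord p) :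
    gMetric f P Z W = fderiv ℝ f P.1 Z.1 * fderiv ℝ f P.1 W.1
      + ∑ i, (Z.1 i * W.2 i + Z.2 i * W.1 i) := by
  simp [gMetric]

/-- The second fundamental form `L_f`: the Hessian of `f` on the `x`-components, zero if one of the
arguments is a combination of the `∂_i^y`. -/
def secondFundForm {p : ℕ} (f : EuclideanSpace ℝ (Fin p) → ℝ) (P Z W : Coord p) : ℝ :=
  fderiv ℝ (fderiv ℝ f) P.1 Z.1 W.1

/-- The restriction of `L_f` to `Span {∂_1^x, …, ∂_p^x}` is positive definite at all points of
`M = O × ℝ^p`. -/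
def SecondFundFormPosDef {p : ℕ} (O : Set (EuclideanSpace ℝ (Fin p)))
    (f : EuclideanSpace ℝ (Fin p) → ℝ) : Prop :=
  ∀ P ∈ carrier O, ∀ ξ : EuclideanSpace ℝ (Fin p), ξ ≠ 0 → 0 < secondFundForm f P (ξ, 0) (ξ, 0)

/-- `f_0 = (x_1² + … + x_p²) / 2`. -/
def fZero (p : ℕ) (x : EuclideanSpace ℝ (Fin p)) : ℝ := (1 / 2 : ℝ) * ∑ i, x i ^ 2

end CurvHom

end

/-! Only the term df ⊗ df of g_f has variable coefficients, and the Koszul formula gives ∇_u v = (0,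
H(u,v) grad f), where H is the Hessian of f on x-components. This is vertical and depends on x
alone. The quadratic Christoffel terms of the curvature therefore vanish, the third derivatives of f
cancel by symmetry, and R(u,v,w,z) = H(u,z) H(v,w) - H(u,w) H(v,z) (`riemann_gMetric`). If H is
positive definite, an H-orthonormal frame in x, its Euclidean dual frame in y and a shear absorbing
df ⊗ df identify the tangent space with the model (`isModeledOn_gMetric`). So metric and curvature
at a point carry no trace of f; only derivatives of R can.

For f_0 the Hessian is constant, so ∇R = 0, and the maps (x, y) ↦ (ε x + c, ε y + h x) with a
suitable quadratic h are isometries: ε = -1 yields the point symmetries, ε = 1 a transitive family.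

For the failure of local homogeneity, an isometry is affine for the Levi-Civita connections
(`fderiv_fderiv_isometry`), hence preserves R (`curvOp_natural`) and, after one more
differentiation, ∇R (`dCurv_isometry`). Christoffel vectors lie in the kernel of H, so ∇R is the
plain derivative of R. For f_0 + x_i⁴ it vanishes at the origin but not at x = e_i. -/

namespace CurvHom

/-! ### The algebraic model. -/

section Algebra

variable {V : Type*} [AddCommGroup V] [Module ℝ V] {p : ℕ}
  (b : Module.Basis (Fin p ⊕ Fin p) ℝ V)

/-- The Euclidean product of the `u`-components. -/
noncomputable def uProd (x y : V) : ℝ := ∑ i, b.repr x (Sum.inl i) * b.repr y (Sum.inl i)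

theorem uProd_comm (x y : V) : uProd b x y = uProd b y x :=
  Finset.sum_congr rfl fun _ _ => mul_comm _ _

theorem uProd_add_left (x y z : V) : uProd b (x + y) z = uProd b x z + uProd b y z := by
  simp [uProd, add_mul, Finset.sum_add_distrib]

theorem uProd_smul_left (c : ℝ) (x z : V) : uProd b (c • x) z = c * uProd b x z := by
  simp [uProd, mul_assoc, Finset.mul_sum]

theorem uProd_add_right (x y z : V) : uProd b z (x + y) = uProd b z x + uProd b z y := by
  simp only [uProd_comm b z, uProd_add_left]

theorem uProd_smul_right (c : ℝ) (x z : V) : uProd b z (c • x) = c * uProd b z x := by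
  simp only [uProd_comm b z, uProd_smul_left]

/-- The Kronecker deltas contract the fourfold sum. All curvature symmetries then follow from
`uProd` being bilinear and symmetric. -/
theorem modelCurvature_eq (x y z w : V) :
    modelCurvature b x y z w = uProd b x w * uProd b y z - uProd b x z * uProd b y w := by
  simp only [modelCurvature, mul_sub, Finset.sum_sub_distrib, uProd]
  congr 1
  · simp [Finset.sum_mul_sum]
    exact Finset.sum_congr rfl fun i _ => Finset.sum_congr rfl fun j _ => by ring
  · simp [Finset.sum_mul_sum]
    exact Finset.sum_congr rfl fun i _ => Finset.sum_congr rfl fun j _ => by ring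

theorem modelInner_inl_inl (i j : Fin p) :
    modelInner b (b (Sum.inl i)) (b (Sum.inl j)) = 0 := by
  simp [modelInner]

theorem modelInner_inl_inr (i j : Fin p) :
    modelInner b (b (Sum.inl i)) (b (Sum.inr j)) = if i = j then 1 else 0 := by
  simp [modelInner, Finsupp.single_apply, eq_comm]

theorem modelInner_inr_inr (i j : Fin p) :
    modelInner b (b (Sum.inr i)) (b (Sum.inr j)) = 0 := by
  simp [modelInner]

theorem modelInner_comm (x y : V) : modelInner b x y = modelInner b y x :=
  Finset.sum_congr rfl fun i _ => by ring

theorem isLinearMap_modelInner (w : V) : IsLinearMap ℝ fun v => modelInner b v w where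
  map_add x y := by
    simp only [modelInner, map_add, Finsupp.add_apply, ← Finset.sum_add_distrib]
    exact Finset.sum_congr rfl fun i _ => by ring
  map_smul c x := by
    simp only [modelInner, map_smul, Finsupp.smul_apply, smul_eq_mul, Finset.mul_sum]
    exact Finset.sum_congr rfl fun i _ => by ring

/-- The coordinate change from the coordinates `(s, t)` of the null basis to those of the basis
`u_i - v_i / 2`, `u_i + v_i / 2`. -/
noncomputable def nullToDiagonal (p : ℕ) : (Fin p ⊕ Fin p → ℝ) ≃ₗ[ℝ] (Fin p ⊕ Fin p → ℝ) where
  toFun c := Sum.elim (fun i => c (Sum.inl i) / 2 - c (Sum.inr i))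
    (fun i => c (Sum.inl i) / 2 + c (Sum.inr i))
  invFun d := Sum.elim (fun i => d (Sum.inl i) + d (Sum.inr i))
    (fun i => (d (Sum.inr i) - d (Sum.inl i)) / 2)
  map_add' c d := by
    ext (i | i) <;> simp <;> ring
  map_smul' r c := by
    ext (i | i) <;> simp <;> ring
  left_inv c := by
    ext (i | i) <;> simp
  right_inv d := by
    ext (i | i) <;> simp <;> ring

theorem modelInner_equivFun_symm (c d : Fin p ⊕ Fin p → ℝ) :
    modelInner b (b.equivFun.symm c) (b.equivFun.symm d) =
      ∑ i, (c (Sum.inl i) * d (Sum.inr i) + c (Sum.inr i) * d (Sum.inl i)) := by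
  simp only [modelInner, ← Module.Basis.equivFun_apply, LinearEquiv.apply_symm_apply]

/-- The vectors u_i - v_i / 2 and u_i + v_i / 2 are mutually orthogonal, of squares -1 and +1. -/
theorem hasSignature_modelInner : HasSignature (modelInner b) p p := by
  refine ⟨modelInner_comm b, isLinearMap_modelInner b,
    Module.Basis.ofEquivFun (b.equivFun.trans (nullToDiagonal p)), fun i => ?_, fun i => ?_, ?_⟩
  · simp [modelInner_equivFun_symm, nullToDiagonal, Pi.single_apply,
      Finset.sum_add_distrib, -Module.Basis.equivFun_symm_apply]
  · simp [modelInner_equivFun_symm, nullToDiagonal, Pi.single_apply,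
      Finset.sum_add_distrib, -Module.Basis.equivFun_symm_apply]
    norm_num
  · rintro (i | i) (j | j) h <;>
    simp [modelInner_equivFun_symm, nullToDiagonal, Pi.single_apply,
      Finset.sum_add_distrib, -Module.Basis.equivFun_symm_apply] <;> grind

theorem HasSignature.of_linearEquiv {W : Type*} [AddCommGroup W] [Module ℝ W]
    {B : V → V → ℝ} {B' : W → W → ℝ} {q r : ℕ} (h : HasSignature B q r) (Ψ : V ≃ₗ[ℝ] W)
    (hΨ : ∀ x y, B' (Ψ x) (Ψ y) = B x y) : HasSignature B' q r := by
  obtain ⟨hs, hl, e, h1, h2, h3⟩ := h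
  have hB (x y : W) : B' x y = B (Ψ.symm x) (Ψ.symm y) := by
    rw [← hΨ, Ψ.apply_symm_apply, Ψ.apply_symm_apply]
  refine ⟨fun v w => by rw [hB, hB, hs], fun w => ⟨fun x y => ?_, fun c x => ?_⟩, e.map Ψ,
    fun i => ?_, fun i => ?_, fun i j hij => ?_⟩
  · simp only [hB, map_add]
    exact (hl _).map_add _ _
  · simp only [hB, map_smul]
    exact (hl _).map_smul _ _
  · simp [hΨ, h1]
  · simp [hΨ, h2]
  · simp [hΨ, h3 i j hij]

theorem modelCurvature_inl (i j k l : Fin p) :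
    modelCurvature b (b (Sum.inl i)) (b (Sum.inl j)) (b (Sum.inl k)) (b (Sum.inl l)) =
      (if i = l then 1 else 0) * (if j = k then 1 else 0)
        - (if i = k then 1 else 0) * (if j = l then 1 else 0) := by
  simp [modelCurvature_eq, uProd, Finsupp.single_apply]

theorem modelCurvature_inr (i : Fin p) (x y z : V) :
    modelCurvature b (b (Sum.inr i)) x y z = 0 ∧ modelCurvature b x (b (Sum.inr i)) y z = 0 ∧
      modelCurvature b x y (b (Sum.inr i)) z = 0 ∧
      modelCurvature b x y z (b (Sum.inr i)) = 0 := by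
  simp [modelCurvature_eq, uProd]

theorem isAlgebraicCurvatureTensor_modelCurvature :
    IsAlgebraicCurvatureTensor (modelCurvature b) := by
  refine ⟨fun _ _ _ => ⟨fun x y => ?_, fun c x => ?_⟩, fun _ _ _ => ⟨fun x y => ?_, fun c x => ?_⟩,
    fun _ _ _ => ⟨fun x y => ?_, fun c x => ?_⟩, fun _ _ _ => ⟨fun x y => ?_, fun c x => ?_⟩,
    fun x y z w => ?_, fun x y z w => ?_, fun x y z w => ?_⟩
  any_goals
    simp only [modelCurvature_eq, uProd_add_left, uProd_smul_left, uProd_add_right,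
      uProd_smul_right, smul_eq_mul]
    ring1
  · rw [modelCurvature_eq, modelCurvature_eq, uProd_comm b z y, uProd_comm b w x,
      uProd_comm b z x, uProd_comm b w y]
    ring
  · rw [modelCurvature_eq, modelCurvature_eq, modelCurvature_eq, uProd_comm b z x,
      uProd_comm b z y, uProd_comm b y x]
    ring

end Algebra

end CurvHom

namespace CurvHom

/-! ### Christoffel symbols and curvature of g_f. -/

section Curvature

open scoped InnerProductSpace

variable {p : ℕ}

/-- The vector of `ℝ^p` representing a linear form. -/
noncomputable def sharp (p : ℕ) :
    (EuclideanSpace ℝ (Fin p) →L[ℝ] ℝ) →L[ℝ] EuclideanSpace ℝ (Fin p) :=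
  ∑ i, (ContinuousLinearMap.apply ℝ ℝ (EuclideanSpace.single i (1 : ℝ))).smulRight
    (EuclideanSpace.single i (1 : ℝ))

theorem inner_sharp_left (φ : EuclideanSpace ℝ (Fin p) →L[ℝ] ℝ) (a : EuclideanSpace ℝ (Fin p)) :
    ⟪sharp p φ, a⟫_ℝ = φ a := by
  have ha : a = ∑ i, a i • EuclideanSpace.single i (1 : ℝ) := by
    ext j
    simp [Finset.sum_apply, Pi.single_apply]
  conv_rhs => rw [ha]
  simp [sharp, sum_inner, inner_smul_left, EuclideanSpace.inner_single_left, mul_comm]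

theorem inner_sharp_right (φ : EuclideanSpace ℝ (Fin p) →L[ℝ] ℝ) (a : EuclideanSpace ℝ (Fin p)) :
    ⟪a, sharp p φ⟫_ℝ = φ a := by
  rw [real_inner_comm, inner_sharp_left]

variable {f : EuclideanSpace ℝ (Fin p) → ℝ}

theorem gMetric_inner (f : EuclideanSpace ℝ (Fin p) → ℝ) (P Z W : Coord p) :
    gMetric f P Z W = fderiv ℝ f P.1 Z.1 * fderiv ℝ f P.1 W.1 + ⟪Z.1, W.2⟫_ℝ + ⟪Z.2, W.1⟫_ℝ := by
  rw [gMetric_apply, Finset.sum_add_distrib, ← add_assoc]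
  simp [PiLp.inner_apply, mul_comm]

/-- Needed because `christoffel` uses `ContinuousLinearMap.inverse`, which is zero on non-invertible
maps. Pairing with (0, Z.1), then with (Z.2, 0), shows that the kernel is trivial. -/
theorem isInvertible_gMetric (f : EuclideanSpace ℝ (Fin p) → ℝ) (P : Coord p) :
    (gMetric f P).IsInvertible := by
  have hinj : Function.Injective (gMetric f P) := by
    rw [injective_iff_map_eq_zero]
    intro Z hZ
    have h (W : Coord p) : gMetric f P Z W = 0 := by rw [hZ]; rfl
    have h1 : Z.1 = 0 := by
      have := h (0, Z.1)
      rw [gMetric_inner] at this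
      simpa using this
    have h2 : Z.2 = 0 := by
      have := h (Z.2, 0)
      rw [gMetric_inner, h1] at this
      simpa using this
    exact Prod.ext h1 h2
  have hdim : Module.finrank ℝ (Coord p) = Module.finrank ℝ (Coord p →L[ℝ] ℝ) := by
    rw [← LinearMap.toContinuousLinearMap.finrank_eq, Subspace.dual_finrank_eq]
  refine ⟨(LinearEquiv.ofInjectiveOfFinrankEq
    ((gMetric f P : Coord p →L[ℝ] Coord p →L[ℝ] ℝ) : Coord p →ₗ[ℝ] Coord p →L[ℝ] ℝ)
    hinj hdim).toContinuousLinearEquiv, ?_⟩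
  exact ContinuousLinearMap.ext fun Z => rfl

theorem contDiffAt_gMetric {P : Coord p} {m n : WithTop ℕ∞} (hf : ContDiffAt ℝ n f P.1)
    (hmn : m + 1 ≤ n) : ContDiffAt ℝ m (gMetric f) P := by
  have h1 : ContDiffAt ℝ m (fun Q : Coord p => fderiv ℝ f Q.1) P :=
    (hf.fderiv_right hmn).comp P contDiffAt_fst
  have h2 : ContDiffAt ℝ m (fun Q : Coord p =>
      (fderiv ℝ f Q.1).comp (ContinuousLinearMap.fst ℝ _ (EuclideanSpace ℝ (Fin p)))) P :=
    h1.clm_comp contDiffAt_const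
  exact (h2.smulRight h2).add contDiffAt_const

/-- The Hessian. -/
noncomputable abbrev hess (f : EuclideanSpace ℝ (Fin p) → ℝ) (x : EuclideanSpace ℝ (Fin p)) :
    EuclideanSpace ℝ (Fin p) →L[ℝ] EuclideanSpace ℝ (Fin p) →L[ℝ] ℝ :=
  fderiv ℝ (fderiv ℝ f) x

theorem hess_comm {x : EuclideanSpace ℝ (Fin p)} (hf : ContDiffAt ℝ 2 f x)
    (a c : EuclideanSpace ℝ (Fin p)) : hess f x a c = hess f x c a :=
  hf.isSymmSndFDerivAt (by simp) a c

theorem fderiv_gMetric {P : Coord p} (hf : ContDiffAt ℝ 2 f P.1) (u v w : Coord p) :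
    fderiv ℝ (gMetric f) P u v w =
      hess f P.1 u.1 v.1 * fderiv ℝ f P.1 w.1 + fderiv ℝ f P.1 v.1 * hess f P.1 u.1 w.1 := by
  have hd : HasFDerivAt (fderiv ℝ f) (hess f P.1) P.1 :=
    ((hf.fderiv_right (m := 1) le_rfl).differentiableAt one_ne_zero).hasFDerivAt
  have hd' (a : EuclideanSpace ℝ (Fin p)) : HasFDerivAt (fun Q : Coord p => fderiv ℝ f Q.1 a)
      (((hess f P.1).flip a).comp (ContinuousLinearMap.fst ℝ _ _)) P := by
    refine ((hd.comp P hasFDerivAt_fst).clm_apply (hasFDerivAt_const a P)).congr_fderiv ?_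
    exact ContinuousLinearMap.ext fun w => by simp
  have hg : HasFDerivAt (gMetric f) (fderiv ℝ (gMetric f) P) P :=
    ((contDiffAt_gMetric (m := 1) hf le_rfl).differentiableAt one_ne_zero).hasFDerivAt
  have h1 := (hg.clm_apply (hasFDerivAt_const v P)).clm_apply (hasFDerivAt_const w P)
  have h2 := (((hd' v.1).mul (hd' w.1)).add_const ⟪v.1, w.2⟫_ℝ).add_const ⟪v.2, w.1⟫_ℝ
  have h3 := h1.unique (h2.congr_of_eventuallyEq (.of_forall fun Q => gMetric_inner f Q v w))
  have h4 := congrArg (fun L => L u) h3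
  simp at h4
  rw [h4]
  ring

/-- In the Koszul expression the terms df · H cancel except for H(u,v) df(w), which is the pairing
of w with a vertical vector. -/
theorem christoffel_gMetric {P : Coord p} (hf : ContDiffAt ℝ 2 f P.1) (u v : Coord p) :
    christoffel (gMetric f) P u v = (0, hess f P.1 u.1 v.1 • sharp p (fderiv ℝ f P.1)) := by
  rw [christoffel, (isInvertible_gMetric f P).inverse_apply_eq]
  refine ContinuousLinearMap.ext fun w => ?_
  rw [gMetric_inner]
  simp only [koszul, smul_apply, sub_apply, add_apply,
    ContinuousLinearMap.flip_apply, fderiv_gMetric hf, smul_eq_mul,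
    map_zero, inner_zero_left, inner_smul_left, inner_sharp_left, hess_comm hf v.1 u.1,
    hess_comm hf w.1]
  simp
  ring

theorem riemann_gMetric {P : Coord p} (hf : ContDiffAt ℝ 3 f P.1) (u v w z : Coord p) :
    riemann (gMetric f) P u v w z =
      hess f P.1 u.1 z.1 * hess f P.1 v.1 w.1 - hess f P.1 u.1 w.1 * hess f P.1 v.1 z.1 := by
  -- The Christoffel formula gets differentiated, so it must hold near P and not only at P.
  have hev : ∀ᶠ Q in nhds P, ContDiffAt ℝ 2 f Q.1 :=
    continuousAt_fst.eventually
      ((hf.eventually (by decide)).mono fun x hx => hx.of_le (by norm_num))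
  have hf2 : ContDiffAt ℝ 2 f P.1 := hev.self_of_nhds
  have hd : HasFDerivAt (fderiv ℝ f) (hess f P.1) P.1 :=
    ((hf2.fderiv_right (m := 1) le_rfl).differentiableAt one_ne_zero).hasFDerivAt
  have hdd : HasFDerivAt (hess f) (fderiv ℝ (hess f) P.1) P.1 :=
    (((hf.fderiv_right (m := 2) le_rfl).fderiv_right (m := 1) le_rfl).differentiableAt
      one_ne_zero).hasFDerivAt
  have hsym : IsSymmSndFDerivAt ℝ (fderiv ℝ f) P.1 :=
    (hf.fderiv_right (m := 2) le_rfl).isSymmSndFDerivAt (by simp)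
  have key (a c e : Coord p) : fderiv ℝ (fun Q => christoffel (gMetric f) Q a c) P e =
      (0, fderiv ℝ (hess f) P.1 e.1 a.1 c.1 • sharp p (fderiv ℝ f P.1) +
        hess f P.1 a.1 c.1 • sharp p (hess f P.1 e.1)) := by
    have h1 : HasFDerivAt (fun x => hess f x a.1 c.1)
        (((fderiv ℝ (hess f) P.1).flip a.1).flip c.1) P.1 := by
      refine ((hdd.clm_apply (hasFDerivAt_const a.1 _)).clm_apply
        (hasFDerivAt_const c.1 _)).congr_fderiv ?_
      exact ContinuousLinearMap.ext fun w => by simp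
    have h2 := (sharp p).hasFDerivAt.comp P.1 hd
    have h3 := (hasFDerivAt_const (0 : EuclideanSpace ℝ (Fin p)) P).prodMk
      ((h1.smul h2).comp P hasFDerivAt_fst)
    have h4 := h3.congr_of_eventuallyEq (f₁ := fun Q => christoffel (gMetric f) Q a c)
      (hev.mono fun Q hQ => christoffel_gMetric hQ a c)
    rw [h4.fderiv]
    simp [add_comm]
  rw [riemann, key, key, christoffel_gMetric hf2 u, christoffel_gMetric hf2 v]
  rw [christoffel_gMetric hf2, christoffel_gMetric hf2, gMetric_inner]
  -- Symmetry of the third derivative cancels its two occurrences, leaving only products of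
  -- Hessians.
  have hs : fderiv ℝ (hess f) P.1 v.1 u.1 = fderiv ℝ (hess f) P.1 u.1 v.1 := hsym v.1 u.1
  simp [inner_sub_left, inner_smul_left, inner_sharp_left, hs]
  ring

end Curvature

end CurvHom

namespace CurvHom

/-! ### Identification of the tangent spaces with the model. -/

section Model

open scoped InnerProductSpace

variable {V : Type*} [AddCommGroup V] [Module ℝ V] {p : ℕ}
  (b : Module.Basis (Fin p ⊕ Fin p) ℝ V) {f : EuclideanSpace ℝ (Fin p) → ℝ}

/-- The coordinates with respect to the basis `b`, as an element of `ℝ^p × ℝ^p`. -/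
noncomputable def toCoord : V ≃ₗ[ℝ] Coord p :=
  b.equivFun ≪≫ₗ LinearEquiv.sumArrowLequivProdArrow _ _ ℝ ℝ ≪≫ₗ
    LinearEquiv.prodCongr (WithLp.linearEquiv 2 ℝ _).symm (WithLp.linearEquiv 2 ℝ _).symm

theorem toCoord_fst_apply (x : V) (i : Fin p) : (toCoord b x).1 i = b.repr x (Sum.inl i) := rfl

theorem toCoord_snd_apply (x : V) (i : Fin p) : (toCoord b x).2 i = b.repr x (Sum.inr i) := rfl

theorem modelInner_eq_inner (x y : V) :
    modelInner b x y =
      ⟪(toCoord b x).1, (toCoord b y).2⟫_ℝ + ⟪(toCoord b x).2, (toCoord b y).1⟫_ℝ := by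
  simp [modelInner, PiLp.inner_apply, toCoord_fst_apply, toCoord_snd_apply,
    Finset.sum_add_distrib, mul_comm]

theorem uProd_eq_inner (x y : V) :
    uProd b x y = ⟪(toCoord b x).1, (toCoord b y).1⟫_ℝ := by
  simp [uProd, PiLp.inner_apply, toCoord_fst_apply, mul_comm]

/-- The isomorphism `(s, t) ↦ (A s, C t - (1/2) df(A s) grad f)` of the model with the tangent space
of `g_f`. -/
noncomputable def nullFrame (φ : EuclideanSpace ℝ (Fin p) →L[ℝ] ℝ)
    (A C : EuclideanSpace ℝ (Fin p) ≃ₗ[ℝ] EuclideanSpace ℝ (Fin p)) : V ≃ₗ[ℝ] Coord p :=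
  toCoord b ≪≫ₗ A.skewProd C
    ((((φ : EuclideanSpace ℝ (Fin p) →ₗ[ℝ] ℝ).smulRight ((-1 / 2 : ℝ) • sharp p φ))).comp
      (A : EuclideanSpace ℝ (Fin p) →ₗ[ℝ] EuclideanSpace ℝ (Fin p)))

theorem nullFrame_apply (φ : EuclideanSpace ℝ (Fin p) →L[ℝ] ℝ)
    (A C : EuclideanSpace ℝ (Fin p) ≃ₗ[ℝ] EuclideanSpace ℝ (Fin p)) (x : V) :
    nullFrame b φ A C x = (A (toCoord b x).1,
      C (toCoord b x).2 + φ (A (toCoord b x).1) • (-1 / 2 : ℝ) • sharp p φ) := rfl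

/-- Each of the two cross pairings contributes -1/2 df(A s) df(A s'), and together they cancel df ⊗
df. -/
theorem gMetric_nullFrame (P : Coord p)
    {A C : EuclideanSpace ℝ (Fin p) ≃ₗ[ℝ] EuclideanSpace ℝ (Fin p)}
    (hAC : ∀ s t, ⟪A s, C t⟫_ℝ = ⟪s, t⟫_ℝ) (x y : V) :
    gMetric f P (nullFrame b (fderiv ℝ f P.1) A C x) (nullFrame b (fderiv ℝ f P.1) A C y) =
      modelInner b x y := by
  have hCA (s t) : ⟪C s, A t⟫_ℝ = ⟪s, t⟫_ℝ := by
    rw [real_inner_comm, hAC, real_inner_comm]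
  rw [gMetric_inner, modelInner_eq_inner, nullFrame_apply, nullFrame_apply]
  simp only [inner_add_left, inner_add_right, inner_smul_left, inner_smul_right, hAC, hCA,
    inner_sharp_left, inner_sharp_right]
  simp
  ring

/-- With A = C = id the shear alone is a linear isometry from the model. -/
theorem hasSignature_gMetric (f : EuclideanSpace ℝ (Fin p) → ℝ) (P : Coord p) :
    HasSignature (fun u v => gMetric f P u v) p p :=
  (hasSignature_modelInner (Pi.basisFun ℝ (Fin p ⊕ Fin p))).of_linearEquiv
    (nullFrame _ (fderiv ℝ f P.1) (LinearEquiv.refl ℝ _) (LinearEquiv.refl ℝ _))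
    fun x y => gMetric_nullFrame _ P (fun _ _ => rfl) x y

theorem isOpen_carrier {O : Set (EuclideanSpace ℝ (Fin p))} (hO : IsOpen O) :
    IsOpen (carrier O) := hO.prod isOpen_univ

theorem isPseudoRiemannian_gMetric {O : Set (EuclideanSpace ℝ (Fin p))} (hO : IsOpen O)
    (hf : ContDiffOn ℝ ∞ f O) : IsPseudoRiemannian (carrier O) (gMetric f) p p :=
  ⟨isOpen_carrier hO, fun _ hP => (contDiffAt_gMetric (m := ∞)
    (hf.contDiffAt (hO.mem_nhds hP.1)) le_rfl).contDiffWithinAt,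
    fun P _ => hasSignature_gMetric f P⟩

/-- A positive definite symmetric form has an orthonormal frame. -/
theorem exists_orthonormal_frame
    (H : EuclideanSpace ℝ (Fin p) →L[ℝ] EuclideanSpace ℝ (Fin p) →L[ℝ] ℝ)
    (hs : ∀ a c, H a c = H c a) (hpos : ∀ a, a ≠ 0 → 0 < H a a) :
    ∃ A : EuclideanSpace ℝ (Fin p) ≃ₗ[ℝ] EuclideanSpace ℝ (Fin p),
      ∀ s t, H (A s) (A t) = ⟪s, t⟫_ℝ := by
  let B : LinearMap.BilinForm ℝ (EuclideanSpace ℝ (Fin p)) := H.toLinearMap₁₂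
  obtain ⟨v', hv'⟩ := LinearMap.BilinForm.exists_orthogonal_basis (B := B) ⟨fun a c => hs a c⟩
  let v := v'.reindex (finCongr (finrank_euclideanSpace_fin (𝕜 := ℝ) (n := p)))
  have hv (i j) (hij : i ≠ j) : H (v i) (v j) = 0 := by
    simp only [v, Module.Basis.reindex_apply]
    exact hv' (fun h => hij ((Equiv.injective _) h))
  have hp (i) : 0 < H (v i) (v i) := hpos _ (v.ne_zero i)
  -- Rescaling factors that make the orthogonal basis orthonormal.
  have hu (i) : IsUnit (Real.sqrt (H (v i) (v i)))⁻¹ :=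
    (inv_ne_zero (Real.sqrt_ne_zero'.2 (hp i))).isUnit
  let e := (EuclideanSpace.basisFun (Fin p) ℝ).toBasis
  let A := e.equiv (v.isUnitSMul hu) (Equiv.refl _)
  have hA (i) : A (e i) = (Real.sqrt (H (v i) (v i)))⁻¹ • v i := by
    simp [A, Module.Basis.isUnitSMul_apply]
  have key : B.compl₁₂ (A : EuclideanSpace ℝ (Fin p) →ₗ[ℝ] EuclideanSpace ℝ (Fin p)) A =
      innerₗ (EuclideanSpace ℝ (Fin p)) := by
    refine e.ext fun i => e.ext fun j => ?_
    change H (A (e i)) (A (e j)) = ⟪e i, e j⟫_ℝ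
    rw [hA, hA]
    have he : ⟪e i, e j⟫_ℝ = if i = j then 1 else 0 := by
      simpa [e] using orthonormal_iff_ite.1 (EuclideanSpace.basisFun (Fin p) ℝ).orthonormal i j
    rw [he]
    split_ifs with h
    · subst h
      have := Real.mul_self_sqrt (hp i).le
      have hne := Real.sqrt_ne_zero'.2 (hp i)
      simp only [map_smul, smul_apply, smul_eq_mul]
      field_simp
      rw [sq, this]
    · simp [hv i j h]
  exact ⟨A, fun s t => LinearMap.congr_fun₂ key s t⟩

theorem isModeledOn_gMetric {O : Set (EuclideanSpace ℝ (Fin p))} (hO : IsOpen O)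
    (hf : ContDiffOn ℝ ∞ f O) (hpos : SecondFundFormPosDef O f) :
    IsModeledOn (carrier O) (gMetric f) (modelInner b) (modelCurvature b) := by
  intro P hP
  have hfP : ContDiffAt ℝ ∞ f P.1 := hf.contDiffAt (hO.mem_nhds hP.1)
  obtain ⟨A, hA⟩ := exists_orthonormal_frame (hess f P.1)
    (hess_comm (hfP.of_le ENat.LEInfty.out)) (hpos P hP)
  -- The inverse transpose of A: since A is H-orthonormal, it equals H ∘ A with covectors turned
  -- into vectors.
  let C' : EuclideanSpace ℝ (Fin p) →ₗ[ℝ] EuclideanSpace ℝ (Fin p) :=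
    (((sharp p).comp (hess f P.1) :
      EuclideanSpace ℝ (Fin p) →L[ℝ] EuclideanSpace ℝ (Fin p)) :
      EuclideanSpace ℝ (Fin p) →ₗ[ℝ] EuclideanSpace ℝ (Fin p)).comp
        (A : EuclideanSpace ℝ (Fin p) →ₗ[ℝ] EuclideanSpace ℝ (Fin p))
  have hC' (s t) : ⟪A s, C' t⟫_ℝ = ⟪s, t⟫_ℝ := by
    rw [← real_inner_comm s t, ← hA t s]
    exact inner_sharp_right _ _
  have hinj : Function.Injective C' := by
    rw [injective_iff_map_eq_zero]
    intro t ht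
    have := hC' t t
    rw [ht, inner_zero_right] at this
    exact inner_self_eq_zero.1 this.symm
  refine ⟨nullFrame b (fderiv ℝ f P.1) A (LinearEquiv.ofInjectiveEndo C' hinj),
    gMetric_nullFrame b P fun s t => by simpa using hC' s t, fun x y z w => ?_⟩
  rw [riemann_gMetric (hfP.of_le ENat.LEInfty.out), modelCurvature_eq]
  simp only [nullFrame_apply, hA, uProd_eq_inner]

end Model

end CurvHom

namespace CurvHom

/-! ### The symmetric space of f_0. -/

section Quadratic

open scoped InnerProductSpace

variable {p : ℕ}

theorem fZero_eq (p : ℕ) : fZero p = fun x => (1 / 2 : ℝ) * ⟪x, x⟫_ℝ := by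
  ext x
  simp [fZero, EuclideanSpace.real_norm_sq_eq]

theorem contDiff_fZero (p : ℕ) : ContDiff ℝ ∞ (fZero p) := by
  rw [fZero_eq]
  exact contDiff_const.mul (contDiff_id.inner ℝ contDiff_id)

theorem hasFDerivAt_fZero (x : EuclideanSpace ℝ (Fin p)) :
    HasFDerivAt (fZero p) (innerSL ℝ x) x := by
  rw [fZero_eq]
  refine (((hasFDerivAt_id x).inner ℝ (hasFDerivAt_id x)).const_mul (1 / 2 : ℝ)).congr_fderiv ?_
  refine ContinuousLinearMap.ext fun a => ?_
  simp [real_inner_comm x a]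
  ring

theorem fderiv_fZero : fderiv ℝ (fZero p) = fun x => innerSL ℝ x :=
  funext fun x => (hasFDerivAt_fZero x).fderiv

theorem hess_fZero (x a c : EuclideanSpace ℝ (Fin p)) : hess (fZero p) x a c = ⟪a, c⟫_ℝ := by
  have h : hess (fZero p) x = innerSL ℝ := by
    rw [hess, fderiv_fZero]
    exact (innerSL ℝ).hasFDerivAt.fderiv
  rw [h]
  rfl

theorem secondFundFormPosDef_fZero (p : ℕ) : SecondFundFormPosDef Set.univ (fZero p) := by
  intro P _ ξ hξ
  change 0 < hess (fZero p) P.1 ξ ξ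
  rw [hess_fZero]
  exact real_inner_self_pos.2 hξ

/-- The constant Hessian makes the components of R constant, and R vanishes on the vertical
Christoffel vectors. -/
theorem isLocallySymmetric_fZero (p : ℕ) :
    IsLocallySymmetric (carrier Set.univ) (gMetric (fZero p)) := by
  intro P _ u v w z e
  have h2 (x) : ContDiffAt ℝ 2 (fZero p) x := (contDiff_fZero p).contDiffAt.of_le ENat.LEInfty.out
  have h3 (x) : ContDiffAt ℝ 3 (fZero p) x := (contDiff_fZero p).contDiffAt.of_le ENat.LEInfty.out
  simp [covDerivRiemann, riemann_gMetric (h3 _), christoffel_gMetric (h2 _), hess_fZero]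

/-- The diffeomorphism `(x, y) ↦ (ε x + c, ε y + h x)` of `ℝ^p × ℝ^p`, where `ε² = 1`. -/
noncomputable def shearHomeomorph {ε : ℝ} (hε : ε * ε = 1) (c : EuclideanSpace ℝ (Fin p))
    {h : EuclideanSpace ℝ (Fin p) → EuclideanSpace ℝ (Fin p)} (hh : Continuous h) :
    Coord p ≃ₜ Coord p where
  toFun P := (ε • P.1 + c, ε • P.2 + h P.1)
  invFun P := (ε • (P.1 - c), ε • (P.2 - h (ε • (P.1 - c))))
  left_inv P := by simp [smul_smul, hε]
  right_inv P := by simp [smul_smul, hε]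
  continuous_toFun := by fun_prop
  continuous_invFun := by fun_prop

theorem hasFDerivAt_shearHomeomorph {ε : ℝ} (hε : ε * ε = 1) (c : EuclideanSpace ℝ (Fin p))
    {h : EuclideanSpace ℝ (Fin p) → EuclideanSpace ℝ (Fin p)} (hh : Continuous h) {P : Coord p}
    {h' : EuclideanSpace ℝ (Fin p) →L[ℝ] EuclideanSpace ℝ (Fin p)} (hd : HasFDerivAt h h' P.1)
    (u : Coord p) :
    fderiv ℝ (shearHomeomorph hε c hh) P u = (ε • u.1, ε • u.2 + h' u.1) := by
  have h1 := ((hasFDerivAt_fst (𝕜 := ℝ) (p := P)).const_smul ε).add_const c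
  have h2 := ((hasFDerivAt_snd (𝕜 := ℝ) (p := P)).const_smul ε).add (hd.comp P hasFDerivAt_fst)
  have h3 : HasFDerivAt (shearHomeomorph hε c hh) _ P := h1.prodMk h2
  rw [h3.fderiv]
  simp

/-- The quadratic correction that makes `(x, y) ↦ (ε x + c, ε y + h x)` an isometry of
`g_{f_0}`. -/
noncomputable def quadShift (ε : ℝ) (c k x : EuclideanSpace ℝ (Fin p)) :
    EuclideanSpace ℝ (Fin p) :=
  (-(1 / 2 : ℝ) * (⟪x, x⟫_ℝ + ε * ⟪c, x⟫_ℝ)) • c + k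

theorem contDiff_quadShift (ε : ℝ) (c k : EuclideanSpace ℝ (Fin p)) :
    ContDiff ℝ ∞ (quadShift ε c k) := by
  exact ((contDiff_const.mul ((contDiff_id.inner ℝ contDiff_id).add
    (contDiff_const.mul (contDiff_const.inner ℝ contDiff_id)))).smul contDiff_const).add
      contDiff_const

theorem hasFDerivAt_quadShift (ε : ℝ) (c k x : EuclideanSpace ℝ (Fin p)) :
    HasFDerivAt (quadShift ε c k)
      ((-(1 / 2 : ℝ) • ((2 : ℝ) • innerSL ℝ x + ε • innerSL ℝ c)).smulRight c) x := by
  have h1 := (hasFDerivAt_id x).inner ℝ (hasFDerivAt_id x)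
  have h2 := ((innerSL ℝ c).hasFDerivAt (x := x)).const_mul ε
  refine ((((h1.add h2).const_mul (-(1 / 2 : ℝ))).smul_const c).add_const k).congr_fderiv ?_
  refine ContinuousLinearMap.ext fun a => ?_
  simp [real_inner_comm x a]
  congr 1
  ring

/-- The isometry `(x, y) ↦ (ε x + c, ε y + h x)` of `g_{f_0}`. -/
noncomputable def quadIsometry {ε : ℝ} (hε : ε * ε = 1) (c k : EuclideanSpace ℝ (Fin p)) :
    OpenPartialHomeomorph (Coord p) (Coord p) :=
  (shearHomeomorph hε c (contDiff_quadShift ε c k).continuous).toOpenPartialHomeomorph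

theorem quadIsometry_apply {ε : ℝ} (hε : ε * ε = 1) (c k : EuclideanSpace ℝ (Fin p))
    (P : Coord p) :
    quadIsometry hε c k P = (ε • P.1 + c, ε • P.2 + quadShift ε c k P.1) := rfl

theorem fderiv_quadIsometry {ε : ℝ} (hε : ε * ε = 1) (c k : EuclideanSpace ℝ (Fin p))
    (P u : Coord p) :
    fderiv ℝ (quadIsometry hε c k) P u =
      (ε • u.1, ε • u.2 + (-(1 / 2 : ℝ) * (2 * ⟪P.1, u.1⟫_ℝ + ε * ⟪c, u.1⟫_ℝ)) • c) :=
  hasFDerivAt_shearHomeomorph hε c _ (hasFDerivAt_quadShift ε c k P.1) u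

theorem isIsometryFor_quadIsometry {ε : ℝ} (hε : ε * ε = 1) (c k : EuclideanSpace ℝ (Fin p)) :
    IsIsometryFor (gMetric (fZero p)) (quadIsometry hε c k) := by
  have hh := contDiff_quadShift ε c k
  refine ⟨ContDiff.contDiffOn ?_, ContDiff.contDiffOn ?_, fun P _ u v => ?_⟩
  · change ContDiff ℝ ∞ fun P : Coord p => (ε • P.1 + c, ε • P.2 + quadShift ε c k P.1)
    fun_prop
  · change ContDiff ℝ ∞ fun P : Coord p =>
      (ε • (P.1 - c), ε • (P.2 - quadShift ε c k (ε • (P.1 - c))))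
    fun_prop
  · rw [fderiv_quadIsometry, fderiv_quadIsometry, gMetric_inner, gMetric_inner,
      quadIsometry_apply]
    simp only [fderiv_fZero, innerSL_apply_apply, inner_add_left, inner_add_right,
      inner_smul_left, inner_smul_right, conj_trivial, real_inner_comm c]
    -- The derivative of `quadShift` cancels the terms in c that the translation adds to df ⊗ df;
    -- what remains is a multiple of ε² - 1.
    linear_combination (⟪P.1, u.1⟫_ℝ * ⟪P.1, v.1⟫_ℝ * (ε * ε + 1) + ⟪u.1, v.2⟫_ℝ + ⟪u.2, v.1⟫_ℝ
      + ε * (⟪P.1, u.1⟫_ℝ * ⟪c, v.1⟫_ℝ + ⟪c, u.1⟫_ℝ * ⟪P.1, v.1⟫_ℝ)) * hε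

theorem isSymmetricSpace_fZero (p : ℕ) :
    IsSymmetricSpace (carrier Set.univ) (gMetric (fZero p)) := by
  have hu : carrier (Set.univ : Set (EuclideanSpace ℝ (Fin p))) = Set.univ := Set.univ_prod_univ
  rw [hu]
  refine ⟨isConnected_univ, fun P _ => ?_⟩
  have hε : (-1 : ℝ) * -1 = 1 := by norm_num
  -- The map x ↦ -x + c fixes P.1 for c = 2 P.1, and then the differential of `quadShift` vanishes
  -- at P. The constant k is chosen so that P.2 is fixed too.
  refine ⟨quadIsometry hε ((2 : ℝ) • P.1)
    ((2 : ℝ) • P.2 - quadShift (-1) ((2 : ℝ) • P.1) 0 P.1), rfl, rfl,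
    isIsometryFor_quadIsometry hε _ _, ?_, fun u => ?_⟩
  · rw [quadIsometry_apply]
    refine Prod.ext ?_ ?_
    · simp only
      module
    · simp only [quadShift]
      module
  · rw [fderiv_quadIsometry]
    refine Prod.ext ?_ ?_ <;> simp [inner_smul_left]

theorem isLocallyHomogeneous_fZero (p : ℕ) :
    IsLocallyHomogeneous (carrier Set.univ) (gMetric (fZero p)) := by
  have hu : carrier (Set.univ : Set (EuclideanSpace ℝ (Fin p))) = Set.univ := Set.univ_prod_univ
  rw [hu]
  intro P _ Q _
  refine ⟨quadIsometry (one_mul 1) (Q.1 - P.1) (Q.2 - P.2 - quadShift 1 (Q.1 - P.1) 0 P.1),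
    Set.subset_univ _, Set.subset_univ _, isIsometryFor_quadIsometry _ _ _, Set.mem_univ _, ?_⟩
  rw [quadIsometry_apply]
  refine Prod.ext ?_ ?_
  · simp only
    module
  · simp only [quadShift]
    module

end Quadratic

end CurvHom

namespace CurvHom

/-! ### Naturality of connection, curvature and its derivative. -/

section Naturality

variable {E : Type*} [NormedAddCommGroup E] [NormedSpace ℝ E]

/-- An isometry is affine for the Levi-Civita connections: if `Γ` is symmetric and compatible
with `g`, then `D²ψ(w, u) = Dψ Γ(w, u) - Γ(Dψ w, Dψ u)`. -/
theorem fderiv_fderiv_isometry {g : E → E →L[ℝ] E →L[ℝ] ℝ} {Γ : E → E →L[ℝ] E →L[ℝ] E}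
    {ψ : E → E} {P : E} (hg : ∀ Q u v, g Q u v = g Q v u)
    (hgd : Differentiable ℝ g) (hnd : ∀ Q, Function.Injective (g Q))
    (hΓ : ∀ Q u v, Γ Q u v = Γ Q v u)
    (hc : ∀ Q w u v, fderiv ℝ g Q w u v = g Q (Γ Q w u) v + g Q u (Γ Q w v))
    (hψ : ContDiffAt ℝ 2 ψ P) (hT : Function.Surjective (fderiv ℝ ψ P))
    (hiso : ∀ᶠ Q in nhds P, ∀ u v, g (ψ Q) (fderiv ℝ ψ Q u) (fderiv ℝ ψ Q v) = g Q u v)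
    (w u : E) :
    fderiv ℝ (fderiv ℝ ψ) P w u =
      fderiv ℝ ψ P (Γ P w u) - Γ (ψ P) (fderiv ℝ ψ P w) (fderiv ℝ ψ P u) := by
  set T := fderiv ℝ ψ P
  set D := fderiv ℝ (fderiv ℝ ψ) P
  have hD : HasFDerivAt (fderiv ℝ ψ) D P :=
    ((hψ.fderiv_right (m := 1) le_rfl).differentiableAt one_ne_zero).hasFDerivAt
  have hT' : HasFDerivAt ψ T P := (hψ.differentiableAt two_ne_zero).hasFDerivAt
  have hsym (a c : E) : D a c = D c a := hψ.isSymmSndFDerivAt (by simp) a c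
  have hT_iso (a c : E) : g (ψ P) (T a) (T c) = g P a c := hiso.self_of_nhds a c
  -- The defect of affinity. It is symmetric because both connections are torsion-free;
  -- differentiating the isometry equation in the direction a gives the skewness in the last two
  -- slots.
  let S (a c : E) : E := D a c - T (Γ P a c) + Γ (ψ P) (T a) (T c)
  have hS_symm (a c : E) : S a c = S c a := by
    simp only [S, hsym a c, hΓ P a c, hΓ (ψ P) (T a)]
  have hS_skew (a c d : E) : g (ψ P) (S a c) (T d) + g (ψ P) (S a d) (T c) = 0 := by
    have h0 : HasFDerivAt (fun Q => g (ψ Q)) ((fderiv ℝ g (ψ P)).comp T) P := by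
      have := HasFDerivAt.comp (g := g) P (hgd (ψ P)).hasFDerivAt hT'
      exact this
    have h1 := (h0.clm_apply
      (hD.clm_apply (hasFDerivAt_const c P))).clm_apply (hD.clm_apply (hasFDerivAt_const d P))
    have h2 := ((hgd P).hasFDerivAt.clm_apply (hasFDerivAt_const c P)).clm_apply
      (hasFDerivAt_const d P)
    have h3 := congrArg (fun L => L a)
      (h1.unique (h2.congr_of_eventuallyEq (hiso.mono fun Q hQ => hQ c d)))
    simp only [ContinuousLinearMap.comp_zero, zero_add, add_apply, ContinuousLinearMap.comp_apply,
      ContinuousLinearMap.flip_apply, hc] at h3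
    simp only [S, map_add, map_sub, add_apply, sub_apply, hT_iso]
    rw [hg (ψ P) (D a d), hg P (Γ P a d), hg (ψ P) (Γ (ψ P) (T a) (T d))]
    linarith
  -- A trilinear form symmetric in its first two slots and skew in its last two is zero.
  have hS (a c d : E) : g (ψ P) (S a c) (T d) = 0 := by
    have h1 := hS_skew a c d
    have h2 := hS_skew d a c
    have h3 := hS_skew c d a
    rw [hS_symm d a] at h2
    rw [hS_symm c d, hS_symm c a] at h3
    linarith
  have hS0 : S w u = 0 := by
    refine hnd (ψ P) ?_
    rw [map_zero]
    refine ContinuousLinearMap.ext fun z => ?_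
    obtain ⟨d, rfl⟩ := hT z
    exact hS w u d
  simp only [S] at hS0
  rw [← sub_eq_zero, ← hS0]
  abel

/-- The curvature operator of the connection with Christoffel form `Γ`. -/
noncomputable def curvOp (Γ : E → E →L[ℝ] E →L[ℝ] E) (P u v w : E) : E :=
  fderiv ℝ Γ P u v w + Γ P u (Γ P v w) - fderiv ℝ Γ P v u w - Γ P v (Γ P u w)

/-- The curvature operator is natural under affine maps. -/
theorem curvOp_natural {Γ : E → E →L[ℝ] E →L[ℝ] E} {ψ : E → E} {P : E}
    (hΓd : Differentiable ℝ Γ) (hψ : ContDiffAt ℝ 3 ψ P)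
    (haff : ∀ᶠ Q in nhds P, ∀ w u, fderiv ℝ (fderiv ℝ ψ) Q w u =
      fderiv ℝ ψ Q (Γ Q w u) - Γ (ψ Q) (fderiv ℝ ψ Q w) (fderiv ℝ ψ Q u)) (u v w : E) :
    fderiv ℝ ψ P (curvOp Γ P u v w) =
      curvOp Γ (ψ P) (fderiv ℝ ψ P u) (fderiv ℝ ψ P v) (fderiv ℝ ψ P w) := by
  have hψ2 : ContDiffAt ℝ 2 (fderiv ℝ ψ) P := hψ.fderiv_right le_rfl
  have hD3 : HasFDerivAt (fderiv ℝ (fderiv ℝ ψ)) (fderiv ℝ (fderiv ℝ (fderiv ℝ ψ)) P) P :=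
    ((hψ2.fderiv_right (m := 1) le_rfl).differentiableAt one_ne_zero).hasFDerivAt
  have hD : HasFDerivAt (fderiv ℝ ψ) (fderiv ℝ (fderiv ℝ ψ) P) P :=
    (hψ2.differentiableAt two_ne_zero).hasFDerivAt
  have hT : HasFDerivAt ψ (fderiv ℝ ψ P) P := (hψ.differentiableAt three_ne_zero).hasFDerivAt
  have hsym2 (a c : E) : fderiv ℝ (fderiv ℝ ψ) P a c = fderiv ℝ (fderiv ℝ ψ) P c a :=
    (hψ.of_le (by norm_num : (2 : WithTop ℕ∞) ≤ 3)).isSymmSndFDerivAt (by simp) a c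
  have hsym3 (a c : E) : fderiv ℝ (fderiv ℝ (fderiv ℝ ψ)) P a c =
      fderiv ℝ (fderiv ℝ (fderiv ℝ ψ)) P c a :=
    hψ2.isSymmSndFDerivAt (by simp) a c
  have haffP := haff.self_of_nhds
  -- The derivative of the affinity equation in the direction a, a formula for D³ψ(a, c, d).
  have key (a c d : E) := by
    have h0 : HasFDerivAt (fun Q => Γ (ψ Q)) ((fderiv ℝ Γ (ψ P)).comp (fderiv ℝ ψ P)) P := by
      have := HasFDerivAt.comp (g := Γ) P (hΓd (ψ P)).hasFDerivAt hT
      exact this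
    have h1 := (hD3.clm_apply (hasFDerivAt_const c P)).clm_apply (hasFDerivAt_const d P)
    have h2 := (hD.clm_apply (((hΓd P).hasFDerivAt.clm_apply (hasFDerivAt_const c P)).clm_apply
      (hasFDerivAt_const d P))).sub
      ((h0.clm_apply (hD.clm_apply (hasFDerivAt_const c P))).clm_apply
        (hD.clm_apply (hasFDerivAt_const d P)))
    have h3 := congrArg (fun L => L a)
      (h1.unique (h2.congr_of_eventuallyEq (haff.mono fun Q hQ => hQ c d)))
    simp only [ContinuousLinearMap.comp_zero, zero_add, add_apply, sub_apply,
      ContinuousLinearMap.comp_apply, ContinuousLinearMap.flip_apply] at h3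
    exact h3
  have h1 := key u v w
  have h2 := key v u w
  -- Integrability: equating D³ψ(u,v,w) and D³ψ(v,u,w), then eliminating second derivatives through
  -- affinity, leaves exactly the two curvatures.
  rw [hsym3, h2, hsym2 v u] at h1
  rw [haffP u (Γ P v w), haffP v (Γ P u w), haffP u w, haffP v w] at h1
  simp only [curvOp, map_add, map_sub]
  simp only [map_sub] at h1
  rw [← sub_eq_zero] at h1 ⊢
  rw [← neg_eq_zero, ← h1]
  abel

/-- The derivative in the direction `e` of `L(u, z) L(v, w) - L(u, w) L(v, z)`. -/
noncomputable def dCurv (L : E → E →L[ℝ] E →L[ℝ] ℝ) (P e u v w z : E) : ℝ :=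
  fderiv ℝ L P e u z * L P v w + L P u z * fderiv ℝ L P e v w
    - (fderiv ℝ L P e u w * L P v z + L P u w * fderiv ℝ L P e v z)

/-- If the tensor `L(u, z) L(v, w) - L(u, w) L(v, z)` is invariant under the affine map `ψ` and the
connections take values in the kernel of `L`, then so is its derivative. -/
theorem dCurv_natural {L : E → E →L[ℝ] E →L[ℝ] ℝ} {ψ : E → E} {P : E}
    {Γ Γ' : E →L[ℝ] E →L[ℝ] E} (hL : Differentiable ℝ L) (hψ : ContDiffAt ℝ 2 ψ P)
    (hcurv : ∀ᶠ Q in nhds P, ∀ u v w z,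
      L (ψ Q) (fderiv ℝ ψ Q u) (fderiv ℝ ψ Q z) * L (ψ Q) (fderiv ℝ ψ Q v) (fderiv ℝ ψ Q w)
        - L (ψ Q) (fderiv ℝ ψ Q u) (fderiv ℝ ψ Q w) * L (ψ Q) (fderiv ℝ ψ Q v) (fderiv ℝ ψ Q z)
      = L Q u z * L Q v w - L Q u w * L Q v z)
    (haff : ∀ a c, fderiv ℝ (fderiv ℝ ψ) P a c =
      fderiv ℝ ψ P (Γ a c) - Γ' (fderiv ℝ ψ P a) (fderiv ℝ ψ P c))
    (hl : ∀ a c d, L P (Γ a c) d = 0) (hr : ∀ a c d, L P d (Γ a c) = 0)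
    (hl' : ∀ a c d, L (ψ P) (Γ' a c) d = 0) (hr' : ∀ a c d, L (ψ P) d (Γ' a c) = 0)
    (e u v w z : E) :
    dCurv L (ψ P) (fderiv ℝ ψ P e) (fderiv ℝ ψ P u) (fderiv ℝ ψ P v) (fderiv ℝ ψ P w)
      (fderiv ℝ ψ P z) = dCurv L P e u v w z := by
  have hT : HasFDerivAt ψ (fderiv ℝ ψ P) P := (hψ.differentiableAt two_ne_zero).hasFDerivAt
  have hD : HasFDerivAt (fderiv ℝ ψ) (fderiv ℝ (fderiv ℝ ψ) P) P :=
    ((hψ.fderiv_right (m := 1) le_rfl).differentiableAt one_ne_zero).hasFDerivAt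
  have h0 : HasFDerivAt (fun Q => L (ψ Q)) ((fderiv ℝ L (ψ P)).comp (fderiv ℝ ψ P)) P := by
    have := HasFDerivAt.comp (g := L) P (hL (ψ P)).hasFDerivAt hT
    exact this
  have hleft (a c : E) := (h0.clm_apply (hD.clm_apply (hasFDerivAt_const a P))).clm_apply
    (hD.clm_apply (hasFDerivAt_const c P))
  have hright (a c : E) := ((hL P).hasFDerivAt.clm_apply (hasFDerivAt_const a P)).clm_apply
    (hasFDerivAt_const c P)
  have h1 := ((hleft u z).mul (hleft v w)).sub ((hleft u w).mul (hleft v z))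
  have h2 := ((hright u z).mul (hright v w)).sub ((hright u w).mul (hright v z))
  have h3 := congrArg (fun A => A e) (h1.unique (h2.congr_of_eventuallyEq
    (hcurv.mono fun Q hQ => hQ u v w z)))
  simp only [ContinuousLinearMap.comp_zero, zero_add, add_apply, sub_apply, smul_apply,
    smul_eq_mul, ContinuousLinearMap.comp_apply, ContinuousLinearMap.flip_apply, haff, map_sub,
    hl', hr', sub_zero] at h3
  have hP := hcurv.self_of_nhds
  -- Only the curvature expression, not L itself, is known to be ψ-invariant. The remaining terms Dψ
  -- Γ(e, ·) are therefore grouped slot by slot into curvature values, each zero because Γ lands in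
  -- the kernel of L.
  have k1 := hP (Γ e u) v w z
  have k2 := hP u (Γ e v) w z
  have k3 := hP u v (Γ e w) z
  have k4 := hP u v w (Γ e z)
  simp only [hl, hr, mul_zero, zero_mul, sub_zero] at k1 k2 k3 k4
  simp only [dCurv]
  linarith

end Naturality

end CurvHom

namespace CurvHom

/-! ### Isometry invariance of R and ∇R for g_f. -/

section Invariance

open scoped InnerProductSpace

variable {p : ℕ} {f : EuclideanSpace ℝ (Fin p) → ℝ}

/-- The Hessian of `f` as a bilinear form on `ℝ^p × ℝ^p`. -/
noncomputable def pullHess (f : EuclideanSpace ℝ (Fin p) → ℝ) (P : Coord p) :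
    Coord p →L[ℝ] Coord p →L[ℝ] ℝ :=
  (hess f P.1).bilinearComp (ContinuousLinearMap.fst ℝ _ _) (ContinuousLinearMap.fst ℝ _ _)

/-- The Christoffel form of `g_f`. -/
noncomputable def chris (f : EuclideanSpace ℝ (Fin p) → ℝ) (P : Coord p) :
    Coord p →L[ℝ] Coord p →L[ℝ] Coord p :=
  ((ContinuousLinearMap.smulRightL ℝ (Coord p) (Coord p)).flip
    (0, sharp p (fderiv ℝ f P.1))).comp (pullHess f P)

theorem pullHess_apply (P u v : Coord p) : pullHess f P u v = hess f P.1 u.1 v.1 := rfl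

theorem chris_apply (P u v : Coord p) :
    chris f P u v = (0, hess f P.1 u.1 v.1 • sharp p (fderiv ℝ f P.1)) := by
  simp [chris, pullHess_apply]

theorem pullHess_chris_left (P Q u v w : Coord p) : pullHess f Q (chris f P u v) w = 0 := by
  simp [pullHess_apply, chris_apply]

theorem pullHess_chris_right (P Q u v w : Coord p) : pullHess f Q w (chris f P u v) = 0 := by
  simp [pullHess_apply, chris_apply]

theorem contDiff_pullHess (hf : ContDiff ℝ ∞ f) : ContDiff ℝ ∞ (pullHess f) := by
  have h1 : ContDiff ℝ ∞ (fderiv ℝ f) := hf.fderiv_right le_rfl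
  have h2 : ContDiff ℝ ∞ (hess f) := h1.fderiv_right le_rfl
  have h3 : ContDiff ℝ ∞ fun P : Coord p => hess f P.1 := h2.comp contDiff_fst
  let ι := ContinuousLinearMap.fst ℝ (EuclideanSpace ℝ (Fin p)) (EuclideanSpace ℝ (Fin p))
  have h4 : ContDiff ℝ ∞ fun P : Coord p =>
      (((ContinuousLinearMap.compL ℝ (Coord p) (EuclideanSpace ℝ (Fin p)) ℝ).flip ι).comp
        (hess f P.1)).comp ι :=
    (contDiff_const.clm_comp h3).clm_comp contDiff_const
  exact h4

theorem contDiff_chris (hf : ContDiff ℝ ∞ f) : ContDiff ℝ ∞ (chris f) := by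
  have h1 : ContDiff ℝ ∞ (fderiv ℝ f) := hf.fderiv_right le_rfl
  have h2 : ContDiff ℝ ∞ fun P : Coord p =>
      ((0, sharp p (fderiv ℝ f P.1)) : Coord p) :=
    contDiff_const.prodMk ((sharp p).contDiff.comp (h1.comp contDiff_fst))
  exact ((ContinuousLinearMap.contDiff _).comp h2).clm_comp (contDiff_pullHess hf)

theorem gMetric_comm (f : EuclideanSpace ℝ (Fin p) → ℝ) (P u v : Coord p) :
    gMetric f P u v = gMetric f P v u :=
  (hasSignature_gMetric f P).1 u v

theorem gMetric_injective (f : EuclideanSpace ℝ (Fin p) → ℝ) (P : Coord p) :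
    Function.Injective (gMetric f P) := by
  obtain ⟨e, he⟩ := isInvertible_gMetric f P
  rw [← he]
  exact e.injective

/-- Metric compatibility, which together with symmetry is all that `fderiv_fderiv_isometry` asks of
the connection. -/
theorem fderiv_gMetric_eq_chris (hf : ContDiff ℝ ∞ f) (P w u v : Coord p) :
    fderiv ℝ (gMetric f) P w u v =
      gMetric f P (chris f P w u) v + gMetric f P u (chris f P w v) := by
  rw [fderiv_gMetric (hf.contDiffAt.of_le ENat.LEInfty.out), gMetric_inner, gMetric_inner,
    chris_apply, chris_apply]
  simp [inner_smul_left, inner_smul_right, inner_sharp_left, inner_sharp_right]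
  ring

theorem riemann_eq_curvOp (hf : ContDiff ℝ ∞ f) (P u v w z : Coord p) :
    riemann (gMetric f) P u v w z = gMetric f P (curvOp (chris f) P u v w) z := by
  have h (Q a c : Coord p) : christoffel (gMetric f) Q a c = chris f Q a c := by
    rw [christoffel_gMetric (hf.contDiffAt.of_le ENat.LEInfty.out), chris_apply]
  have hd : DifferentiableAt ℝ (chris f) P := (contDiff_chris hf).differentiable (by simp) P
  have h' (a c e : Coord p) :
      fderiv ℝ (fun Q => chris f Q a c) P e = fderiv ℝ (chris f) P e a c := by
    rw [((hd.hasFDerivAt.clm_apply (hasFDerivAt_const a P)).clm_apply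
      (hasFDerivAt_const c P)).fderiv]
    simp
  simp only [riemann, h, h', curvOp]

/-- Preserving a nondegenerate form forces injectivity, which suffices in finite dimension. -/
theorem surjective_fderiv_of_isometry {g : Coord p → Coord p →L[ℝ] Coord p →L[ℝ] ℝ}
    {P Q : Coord p} {T : Coord p →L[ℝ] Coord p} (hnd : Function.Injective (g P))
    (h : ∀ u v, g Q (T u) (T v) = g P u v) : Function.Surjective T := by
  have hinj : Function.Injective (T : Coord p →ₗ[ℝ] Coord p) := by
    rw [injective_iff_map_eq_zero]
    intro u hu
    refine hnd ?_
    rw [map_zero]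
    refine ContinuousLinearMap.ext fun v => ?_
    rw [← h, show T u = 0 from hu]
    simp
  exact LinearMap.injective_iff_surjective.1 hinj

theorem riemann_gMetric_pullHess (hf : ContDiff ℝ ∞ f) (P u v w z : Coord p) :
    riemann (gMetric f) P u v w z =
      pullHess f P u z * pullHess f P v w - pullHess f P u w * pullHess f P v z :=
  riemann_gMetric (hf.contDiffAt.of_le ENat.LEInfty.out) u v w z

theorem fderiv_fderiv_isometry_gMetric (hf : ContDiff ℝ ∞ f)
    {ψ : OpenPartialHomeomorph (Coord p) (Coord p)} (hψ : IsIsometryFor (gMetric f) ψ)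
    {Q : Coord p} (hQ : Q ∈ ψ.source) (a c : Coord p) :
    fderiv ℝ (fderiv ℝ ψ) Q a c =
      fderiv ℝ ψ Q (chris f Q a c) - chris f (ψ Q) (fderiv ℝ ψ Q a) (fderiv ℝ ψ Q c) := by
  have hf2 (x) : ContDiffAt ℝ 2 f x := hf.contDiffAt.of_le ENat.LEInfty.out
  have hnhds := ψ.open_source.mem_nhds hQ
  refine fderiv_fderiv_isometry (gMetric_comm f)
    (fun R => (contDiffAt_gMetric (m := 1) (hf2 _) le_rfl).differentiableAt one_ne_zero)
    (gMetric_injective f) (fun R a c => ?_) (fderiv_gMetric_eq_chris hf)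
    ((hψ.1.contDiffAt hnhds).of_le ENat.LEInfty.out)
    (surjective_fderiv_of_isometry (gMetric_injective f Q) (hψ.2.2 Q hQ))
    (Filter.eventually_of_mem hnhds hψ.2.2) a c
  rw [chris_apply, chris_apply, hess_comm (hf2 _)]

theorem riemann_isometry (hf : ContDiff ℝ ∞ f) {ψ : OpenPartialHomeomorph (Coord p) (Coord p)}
    (hψ : IsIsometryFor (gMetric f) ψ) {P : Coord p} (hP : P ∈ ψ.source) (u v w z : Coord p) :
    riemann (gMetric f) (ψ P) (fderiv ℝ ψ P u) (fderiv ℝ ψ P v) (fderiv ℝ ψ P w)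
      (fderiv ℝ ψ P z) = riemann (gMetric f) P u v w z := by
  rw [riemann_eq_curvOp hf, riemann_eq_curvOp hf, ← curvOp_natural
    ((contDiff_chris hf).differentiable (by simp))
    ((hψ.1.contDiffAt (ψ.open_source.mem_nhds hP)).of_le ENat.LEInfty.out)
    (Filter.eventually_of_mem (ψ.open_source.mem_nhds hP)
      fun R hR => fderiv_fderiv_isometry_gMetric hf hψ hR), hψ.2.2 P hP]

/-- Isometries preserve the covariant derivative of the curvature tensor. -/
theorem dCurv_isometry (hf : ContDiff ℝ ∞ f) {ψ : OpenPartialHomeomorph (Coord p) (Coord p)}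
    (hψ : IsIsometryFor (gMetric f) ψ) {P : Coord p} (hP : P ∈ ψ.source) (e u v w z : Coord p) :
    dCurv (pullHess f) (ψ P) (fderiv ℝ ψ P e) (fderiv ℝ ψ P u) (fderiv ℝ ψ P v) (fderiv ℝ ψ P w)
      (fderiv ℝ ψ P z) = dCurv (pullHess f) P e u v w z := by
  refine dCurv_natural ((contDiff_pullHess hf).differentiable (by simp))
    ((hψ.1.contDiffAt (ψ.open_source.mem_nhds hP)).of_le ENat.LEInfty.out)
    (Filter.eventually_of_mem (ψ.open_source.mem_nhds hP) fun Q hQ a c d k => ?_)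
    (fderiv_fderiv_isometry_gMetric hf hψ hP) (pullHess_chris_left P P) (pullHess_chris_right P P)
    (pullHess_chris_left (ψ P) (ψ P)) (pullHess_chris_right (ψ P) (ψ P)) e u v w z
  simpa only [riemann_gMetric_pullHess hf] using riemann_isometry hf hψ hQ a c d k

end Invariance

end CurvHom

namespace CurvHom

/-! ### A metric that is not locally homogeneous. -/

section Quartic

open scoped InnerProductSpace

variable {p : ℕ}

/-- The function `f_0 + x_i⁴`. -/
noncomputable def fQuartic (i : Fin p) (x : EuclideanSpace ℝ (Fin p)) : ℝ :=
  fZero p x + EuclideanSpace.proj (𝕜 := ℝ) i x ^ 4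

theorem contDiff_fQuartic (i : Fin p) : ContDiff ℝ ∞ (fQuartic i) :=
  (contDiff_fZero p).add ((EuclideanSpace.proj (𝕜 := ℝ) i).contDiff.pow 4)

theorem fderiv_fQuartic (i : Fin p) : fderiv ℝ (fQuartic i) = fun x =>
    innerSL ℝ x + (4 * EuclideanSpace.proj (𝕜 := ℝ) i x ^ 3) • EuclideanSpace.proj (𝕜 := ℝ) i := by
  ext1 x
  let π : EuclideanSpace ℝ (Fin p) →L[ℝ] ℝ := EuclideanSpace.proj i
  have h := (hasFDerivAt_fZero x).add
    ((π.hasFDerivAt (x := x)).pow 4)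
  refine (HasFDerivAt.fderiv (f := fQuartic i) h).trans ?_
  simp [π]

theorem hess_fQuartic (i : Fin p) (x a c : EuclideanSpace ℝ (Fin p)) :
    hess (fQuartic i) x a c = ⟪a, c⟫_ℝ + 12 * x i ^ 2 * a i * c i := by
  let π : EuclideanSpace ℝ (Fin p) →L[ℝ] ℝ := EuclideanSpace.proj i
  have h1 := (((π.hasFDerivAt (x := x)).pow 3).const_mul 4).smul_const π
  have h2 := ((innerSL ℝ : EuclideanSpace ℝ (Fin p) →L[ℝ] _).hasFDerivAt (x := x)).add h1
  rw [hess, fderiv_fQuartic]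
  refine (congrArg (fun L => L a c) (HasFDerivAt.fderiv h2)).trans ?_
  simp [π]
  change ⟪a, c⟫_ℝ + _ = _
  ring

theorem secondFundFormPosDef_fQuartic (i : Fin p) :
    SecondFundFormPosDef Set.univ (fQuartic i) := by
  intro P _ ξ hξ
  change 0 < hess (fQuartic i) P.1 ξ ξ
  rw [hess_fQuartic, mul_assoc]
  have h1 : 0 < ⟪ξ, ξ⟫_ℝ := real_inner_self_pos.2 hξ
  have h2 := mul_self_nonneg (ξ i)
  positivity

theorem fderiv_pullHess_fQuartic (i : Fin p) (P e u v : Coord p) :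
    fderiv ℝ (pullHess (fQuartic i)) P e u v = 24 * P.1 i * e.1 i * u.1 i * v.1 i := by
  have h1 := (((contDiff_pullHess (contDiff_fQuartic i)).differentiable (by simp)
    P).hasFDerivAt.clm_apply (hasFDerivAt_const u P)).clm_apply (hasFDerivAt_const v P)
  let π : Coord p →L[ℝ] ℝ := (EuclideanSpace.proj (𝕜 := ℝ) i).comp (ContinuousLinearMap.fst ℝ _ _)
  have h2 := ((((π.hasFDerivAt (x := P)).pow 2).const_mul 12).mul_const
    (u.1 i)).mul_const (v.1 i) |>.const_add ⟪u.1, v.1⟫_ℝ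
  have h3 := congrArg (fun L => L e) (h1.unique (h2.congr_of_eventuallyEq
    (.of_forall fun Q => hess_fQuartic i Q.1 u.1 v.1)))
  simp [π] at h3
  rw [h3]
  ring

/-- The derivative of H is 24 x_i dx_i³, so ∇R is zero at the origin. At x = e_i the component of ∇R
on the plane of e_i, e_j in the direction e_i is 24, so no isometry joins the two points. -/
theorem not_isLocallyHomogeneous_fQuartic {i j : Fin p} (hij : i ≠ j) :
    ¬ IsLocallyHomogeneous (carrier Set.univ) (gMetric (fQuartic i)) := by
  intro h
  let ex : Coord p := (EuclideanSpace.single i 1, 0)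
  let ey : Coord p := (EuclideanSpace.single j 1, 0)
  obtain ⟨ψ, -, -, hψ, h0, hψ0⟩ := h 0 ⟨Set.mem_univ _, Set.mem_univ _⟩ ex
    ⟨Set.mem_univ _, Set.mem_univ _⟩
  have hs := surjective_fderiv_of_isometry (gMetric_injective (fQuartic i) 0) (hψ.2.2 0 h0)
  -- Preimages under the differential suffice: whatever u and v are, the derivative at the origin
  -- vanishes on them.
  obtain ⟨u, hu⟩ := hs ex
  obtain ⟨v, hv⟩ := hs ey
  have key := dCurv_isometry (contDiff_fQuartic i) hψ h0 u u v v u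
  rw [hu, hv, hψ0] at key
  simp [dCurv, fderiv_pullHess_fQuartic, pullHess_apply, hess_fQuartic, ex, ey, hij,
    EuclideanSpace.inner_single_left, hij.symm] at key

end Quartic

end CurvHom

theorem mainTheorem2 (p : ℕ) {V : Type*} [AddCommGroup V] [Module ℝ V]
    (b : Module.Basis (Fin p ⊕ Fin p) ℝ V) :
    -- the model: its entries, its inner product, its algebraic curvature tensor
    ((∀ i j, CurvHom.modelInner b (b (Sum.inl i)) (b (Sum.inl j)) = 0) ∧
      (∀ i j, CurvHom.modelInner b (b (Sum.inl i)) (b (Sum.inr j)) = if i = j then 1 else 0) ∧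
      (∀ i j, CurvHom.modelInner b (b (Sum.inr i)) (b (Sum.inr j)) = 0) ∧
      CurvHom.HasSignature (CurvHom.modelInner b) p p) ∧
    ((∀ i j k l, CurvHom.modelCurvature b (b (Sum.inl i)) (b (Sum.inl j)) (b (Sum.inl k))
          (b (Sum.inl l)) = (if i = l then 1 else 0) * (if j = k then 1 else 0)
            - (if i = k then 1 else 0) * (if j = l then 1 else 0)) ∧
      (∀ (i : Fin p) (x y z : V),
        CurvHom.modelCurvature b (b (Sum.inr i)) x y z = 0 ∧
        CurvHom.modelCurvature b x (b (Sum.inr i)) y z = 0 ∧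
        CurvHom.modelCurvature b x y (b (Sum.inr i)) z = 0 ∧
        CurvHom.modelCurvature b x y z (b (Sum.inr i)) = 0) ∧
      CurvHom.IsAlgebraicCurvatureTensor (CurvHom.modelCurvature b)) ∧
    -- it is a model for all the manifolds with positive definite second fundamental form
    (∀ (O : Set (EuclideanSpace ℝ (Fin p))) (f : EuclideanSpace ℝ (Fin p) → ℝ),
      IsOpen O → ContDiffOn ℝ ∞ f O →
      CurvHom.IsPseudoRiemannian (CurvHom.carrier O) (CurvHom.gMetric f) p p ∧
      (CurvHom.SecondFundFormPosDef O f →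
        CurvHom.IsModeledOn (CurvHom.carrier O) (CurvHom.gMetric f)
          (CurvHom.modelInner b) (CurvHom.modelCurvature b))) ∧
    -- among them the symmetric space given by the quadratic function
    (CurvHom.SecondFundFormPosDef Set.univ (CurvHom.fZero p) ∧
      CurvHom.IsPseudoRiemannian (CurvHom.carrier Set.univ)
        (CurvHom.gMetric (CurvHom.fZero p)) p p ∧
      CurvHom.IsModeledOn (CurvHom.carrier Set.univ) (CurvHom.gMetric (CurvHom.fZero p))
        (CurvHom.modelInner b) (CurvHom.modelCurvature b) ∧
      CurvHom.IsLocallySymmetric (CurvHom.carrier Set.univ)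
        (CurvHom.gMetric (CurvHom.fZero p)) ∧
      CurvHom.IsSymmetricSpace (CurvHom.carrier Set.univ) (CurvHom.gMetric (CurvHom.fZero p)) ∧
      CurvHom.IsLocallyHomogeneous (CurvHom.carrier Set.univ)
        (CurvHom.gMetric (CurvHom.fZero p))) ∧
    -- while some of them are not locally homogeneous
    (3 ≤ p → ∃ f : EuclideanSpace ℝ (Fin p) → ℝ, ContDiff ℝ ∞ f ∧
      CurvHom.SecondFundFormPosDef Set.univ f ∧
      CurvHom.IsPseudoRiemannian (CurvHom.carrier Set.univ) (CurvHom.gMetric f) p p ∧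
      CurvHom.IsModeledOn (CurvHom.carrier Set.univ) (CurvHom.gMetric f)
        (CurvHom.modelInner b) (CurvHom.modelCurvature b) ∧
      ¬ CurvHom.IsLocallyHomogeneous (CurvHom.carrier Set.univ) (CurvHom.gMetric f)) := by
  have hu : IsOpen (Set.univ : Set (EuclideanSpace ℝ (Fin p))) := isOpen_univ
  refine ⟨⟨CurvHom.modelInner_inl_inl b, CurvHom.modelInner_inl_inr b,
    CurvHom.modelInner_inr_inr b, CurvHom.hasSignature_modelInner b⟩,
    ⟨CurvHom.modelCurvature_inl b, CurvHom.modelCurvature_inr b,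
      CurvHom.isAlgebraicCurvatureTensor_modelCurvature b⟩,
    fun O f hO hf => ⟨CurvHom.isPseudoRiemannian_gMetric hO hf,
      CurvHom.isModeledOn_gMetric b hO hf⟩, ?_, fun hp => ?_⟩
  · have h0 := (CurvHom.contDiff_fZero p).contDiffOn (s := Set.univ)
    exact ⟨CurvHom.secondFundFormPosDef_fZero p, CurvHom.isPseudoRiemannian_gMetric hu h0,
      CurvHom.isModeledOn_gMetric b hu h0 (CurvHom.secondFundFormPosDef_fZero p),
      CurvHom.isLocallySymmetric_fZero p, CurvHom.isSymmetricSpace_fZero p,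
      CurvHom.isLocallyHomogeneous_fZero p⟩
  · let i : Fin p := ⟨0, by omega⟩
    have hf := CurvHom.contDiff_fQuartic i
    have hpos := CurvHom.secondFundFormPosDef_fQuartic i
    have hij : i ≠ ⟨1, by omega⟩ := by simp [i]
    exact ⟨CurvHom.fQuartic i, hf, hpos, CurvHom.isPseudoRiemannian_gMetric hu hf.contDiffOn,
      CurvHom.isModeledOn_gMetric b hu hf.contDiffOn hpos,
      CurvHom.not_isLocallyHomogeneous_fQuartic hij⟩
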